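/- Let $F$ be Thompson's group, i.e. the group under composition of all orientation-preserving piecewise linear homeomorphisms of $[0,1]$ onto itself that are differentiable except at finitely many dyadic rationals and whose slopes on the intervals of differentiability are integral powers of $2$. Let $C^*_r(F)$ be the reduced group $C^*$-algebra of $F$ (the norm closure in $B(\ell^2(F))$ of the linear span of the left translations $(L_g\psi)(h)=\psi(g^{-1}h)$, $g\in F$), and let $C^*(F)$ be the full group $C^*$-algebra of $F$ (the completion of the group algebra $\mathbb{C}[F]$ in the norm $\|x\|=\sup_\pi\|\pi(x)\|$, where $\pi$ runs over the unitary representations of $F$). A $C^*$-algebra $R$ is called residually finite dimensional if for each nonzero $x\in R$ there are a finite dimensional $C^*$-algebra $B$ and a $*$-homomorphism $\pi:R\to B$ with $\pi(x)\neq 0$. **Theorem.** Neither $C^*_r(F)$ nor $C^*(F)$ is residually finite dimensional. -/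

import Mathlib

open scoped ENNReal

/-! ### Thompson's group `F` -/

/-- The dyadic rationals `m / 2 ^ k` as a set of real numbers. -/
def dyadicRationals : Set ℝ := {x | ∃ (m : ℤ) (k : ℕ), x = m / 2 ^ k}

/-- `IsThompsonMap f`: the homeomorphism `f` of `[0,1]` is orientation preserving, and there is a
finite set `S` of dyadic rationals such that on each interval with no point of `S` in its interior
`f` is affine with slope an integral power of `2`. -/
def IsThompsonMap (f : unitInterval ≃ₜ unitInterval) : Prop :=
  StrictMono f ∧ ∃ S : Set unitInterval, S.Finite ∧ (∀ s ∈ S, (s : ℝ) ∈ dyadicRationals) ∧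
    ∀ a b : unitInterval, a < b → Disjoint (Set.Ioo a b) S →
      ∃ n : ℤ, ∀ t ∈ Set.Icc a b, (f t : ℝ) = f a + 2 ^ n * ((t : ℝ) - a)

theorem dyadicRationals_add {x y : ℝ} (hx : x ∈ dyadicRationals) (hy : y ∈ dyadicRationals) :
    x + y ∈ dyadicRationals := by
  obtain ⟨m, k, rfl⟩ := hx
  obtain ⟨n, l, rfl⟩ := hy
  refine ⟨m * 2 ^ l + n * 2 ^ k, k + l, ?_⟩
  push_cast
  field_simp
  ring

theorem dyadicRationals_sub {x y : ℝ} (hx : x ∈ dyadicRationals) (hy : y ∈ dyadicRationals) :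
    x - y ∈ dyadicRationals := by
  obtain ⟨n, l, rfl⟩ := hy
  rw [sub_eq_add_neg]
  exact dyadicRationals_add hx ⟨-n, l, by push_cast; ring⟩

theorem dyadicRationals_zpow_mul {x : ℝ} (hx : x ∈ dyadicRationals) (n : ℤ) :
    2 ^ n * x ∈ dyadicRationals := by
  obtain ⟨m, k, rfl⟩ := hx
  obtain ⟨j, rfl | rfl⟩ := n.eq_nat_or_neg
  · exact ⟨2 ^ j * m, k, by push_cast; rw [zpow_natCast]; ring⟩
  · refine ⟨m, k + j, ?_⟩
    rw [zpow_neg, zpow_natCast, pow_add]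
    field_simp

theorem strictMono_map_zero {f : unitInterval ≃ₜ unitInterval} (hf : StrictMono f) : f 0 = 0 := by
  refine le_antisymm ?_ bot_le
  have h := hf.monotone (show (0 : unitInterval) ≤ f.symm 0 from bot_le)
  simpa using h

/-- The maps in Thompson's group send dyadic rationals to dyadic rationals. -/
theorem IsThompsonMap.dyadic {f : unitInterval ≃ₜ unitInterval} (hf : IsThompsonMap f)
    (t : unitInterval) (ht : (t : ℝ) ∈ dyadicRationals) : (f t : ℝ) ∈ dyadicRationals := by
  obtain ⟨hm, S, hS, hSd, haff⟩ := hf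
  have key : ∀ N : ℕ, ∀ t : unitInterval, (S ∩ Set.Iio t).ncard ≤ N →
      (t : ℝ) ∈ dyadicRationals → (f t : ℝ) ∈ dyadicRationals := by
    intro N
    induction N using Nat.strong_induction_on with
    | _ N ih =>
      intro t hN ht
      by_cases h0 : (0 : unitInterval) < t
      · have hfin : (S ∩ Set.Iio t).Finite := hS.subset Set.inter_subset_left
        by_cases hne : (S ∩ Set.Iio t).Nonempty
        · obtain ⟨s, ⟨hsS, hst⟩, hmax⟩ := Set.exists_max_image _ id hfin hne
          have hlt : (S ∩ Set.Iio s).ncard < (S ∩ Set.Iio t).ncard := by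
            refine Set.ncard_lt_ncard ⟨fun x hx => ⟨hx.1, lt_trans (Set.mem_Iio.1 hx.2) hst⟩, fun h => ?_⟩ hfin
            exact lt_irrefl s (h ⟨hsS, hst⟩).2
          have hs := ih _ (lt_of_lt_of_le hlt hN) s le_rfl (hSd s hsS)
          obtain ⟨n, hn⟩ := haff s t hst (Set.disjoint_left.2 fun x hx hxS =>
            absurd (hmax x ⟨hxS, hx.2⟩) (not_le.2 hx.1))
          rw [hn t ⟨le_of_lt hst, le_rfl⟩]
          exact dyadicRationals_add hs
            (dyadicRationals_zpow_mul (dyadicRationals_sub ht (hSd s hsS)) n)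
        · obtain ⟨n, hn⟩ := haff 0 t h0 (Set.disjoint_left.2 fun x hx hxS =>
            hne ⟨x, hxS, hx.2⟩)
          rw [hn t ⟨le_of_lt h0, le_rfl⟩, strictMono_map_zero hm]
          simpa using dyadicRationals_zpow_mul ht n
      · have : t = 0 := le_antisymm (not_lt.1 h0) bot_le
        subst this
        rw [strictMono_map_zero hm]
        exact ht
  exact key _ t le_rfl ht

theorem IsThompsonMap.one : IsThompsonMap 1 :=
  ⟨strictMono_id, ∅, Set.finite_empty, by simp, fun a b _ _ => ⟨0, fun t _ => by simp⟩⟩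

theorem IsThompsonMap.inv {f : unitInterval ≃ₜ unitInterval} (hf : IsThompsonMap f) :
    IsThompsonMap f⁻¹ := by
  have hd := hf.dyadic
  obtain ⟨hm, S, hS, hSd, haff⟩ := hf
  have hi : ∀ x, f (f⁻¹ x) = x := fun x => f.apply_symm_apply x
  have hm' : StrictMono (f⁻¹ : unitInterval ≃ₜ unitInterval) := fun x y hxy => by
    rw [← hm.lt_iff_lt, hi, hi]; exact hxy
  refine ⟨hm', f '' S, hS.image f, ?_, ?_⟩
  · rintro _ ⟨s, hs, rfl⟩
    exact hd s (hSd s hs)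
  · intro a b hab hdis
    obtain ⟨n, hn⟩ := haff (f⁻¹ a) (f⁻¹ b) (hm' hab) (Set.disjoint_left.2 fun x hx hxS => by
      refine Set.disjoint_left.1 hdis ?_ (Set.mem_image_of_mem f hxS)
      have h1 := hm hx.1
      have h2 := hm hx.2
      rw [hi] at h1 h2
      exact ⟨h1, h2⟩)
    refine ⟨-n, fun t ht => ?_⟩
    have h := hn (f⁻¹ t) ⟨hm'.monotone ht.1, hm'.monotone ht.2⟩
    rw [hi, hi] at h
    rw [h, zpow_neg]
    have : (2 : ℝ) ^ n ≠ 0 := by positivity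
    field_simp
    ring

theorem IsThompsonMap.mul {f g : unitInterval ≃ₜ unitInterval} (hf : IsThompsonMap f)
    (hg : IsThompsonMap g) : IsThompsonMap (f * g) := by
  have hgi := hg.inv.dyadic
  obtain ⟨hfm, S, hS, hSd, hfa⟩ := hf
  obtain ⟨hgm, T, hT, hTd, hga⟩ := hg
  have hi : ∀ x, g⁻¹ (g x) = x := fun x => g.symm_apply_apply x
  have happ : ∀ x, (f * g) x = f (g x) := fun _ => rfl
  refine ⟨fun x y hxy => hfm (hgm hxy), T ∪ (g⁻¹ : unitInterval ≃ₜ unitInterval) '' S,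
    hT.union (hS.image _), ?_, ?_⟩
  · rintro _ (h | ⟨s, hs, rfl⟩)
    · exact hTd _ h
    · exact hgi s (hSd s hs)
  · intro a b hab hdis
    rw [Set.disjoint_union_right] at hdis
    obtain ⟨m, hm⟩ := hga a b hab hdis.1
    obtain ⟨n, hn⟩ := hfa (g a) (g b) (hgm hab) (Set.disjoint_left.2 fun x hx hxS => by
      refine Set.disjoint_left.1 hdis.2 ?_ (Set.mem_image_of_mem _ hxS)
      have hx' : g (g⁻¹ x) = x := g.apply_symm_apply x
      constructor
      · rw [← hgm.lt_iff_lt, hx']; exact hx.1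
      · rw [← hgm.lt_iff_lt, hx']; exact hx.2)
    refine ⟨n + m, fun t ht => ?_⟩
    rw [happ, happ, hn (g t) ⟨hgm.monotone ht.1, hgm.monotone ht.2⟩, hm t ht,
      zpow_add₀ two_ne_zero]
    ring

/-- Thompson's group `F`, a group under composition of maps. -/
def ThompsonF : Subgroup (unitInterval ≃ₜ unitInterval) where
  carrier := {f | IsThompsonMap f}
  mul_mem' := IsThompsonMap.mul
  one_mem' := IsThompsonMap.one
  inv_mem' := IsThompsonMap.inv

/-! ### Group C*-algebras -/

noncomputable section

universe u

/-- The Hilbert space `ℓ²(G)`. -/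
abbrev GroupL2 (G : Type u) : Type u := lp (fun _ : G => ℂ) 2

/-- The translate `h ↦ ψ (g⁻¹ h)` of a square summable function `ψ`. -/
def leftTranslate {G : Type u} [Group G] (g : G) (ψ : GroupL2 G) : GroupL2 G :=
  ⟨fun h => ψ (g⁻¹ * h), by
    have h := (memℓp_gen_iff (p := 2) (by norm_num)).1 ψ.2
    exact (memℓp_gen_iff (p := 2) (by norm_num)).2 ((Equiv.mulLeft g⁻¹).summable_iff.2 h)⟩

theorem leftTranslate_apply {G : Type u} [Group G] (g : G) (ψ : GroupL2 G) (h : G) :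
    leftTranslate g ψ h = ψ (g⁻¹ * h) := rfl

/-- The left regular representation `(L_g ψ)(h) = ψ (g⁻¹ h)` by isometries of `ℓ²(G)`. -/
def leftRegularIsometry (G : Type u) [Group G] : G →* (GroupL2 G ≃ₗᵢ[ℂ] GroupL2 G) where
  toFun g :=
    { toFun := leftTranslate g
      invFun := leftTranslate g⁻¹
      left_inv := fun ψ => by ext h; simp [leftTranslate_apply]
      right_inv := fun ψ => by ext h; simp [leftTranslate_apply]
      map_add' := fun ψ φ => by ext h; simp [leftTranslate_apply]
      map_smul' := fun c ψ => by ext h; simp [leftTranslate_apply]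
      norm_map' := fun ψ => by
        have h2 : 0 < (2 : ℝ≥0∞).toReal := by norm_num
        rw [lp.norm_eq_tsum_rpow h2, lp.norm_eq_tsum_rpow h2]
        congr 1
        exact (Equiv.mulLeft g⁻¹).tsum_eq fun h => ‖ψ h‖ ^ (2 : ℝ≥0∞).toReal }
  map_one' := by ext ψ h; simp [leftTranslate_apply]
  map_mul' g₁ g₂ := by ext ψ h; simp [leftTranslate_apply, mul_assoc]

/-- The left regular representation `g ↦ L_g` by unitary operators in `B(ℓ²(G))`. -/
def leftRegularRep (G : Type u) [Group G] : G →* unitary (GroupL2 G →L[ℂ] GroupL2 G) :=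
  (Unitary.linearIsometryEquiv (𝕜 := ℂ) (H := GroupL2 G)).symm.toMonoidHom.comp
    (leftRegularIsometry G)

/-- The C*-subalgebra of `A` generated by the unitaries `u g`, that is, the norm closure of the
*-algebra that they generate (which is their linear span). -/
def generatedCStar {G : Type*} [Group G] {A : Type*} [CStarAlgebra A] (u : G →* unitary A) :
    StarSubalgebra ℂ A :=
  (StarAlgebra.adjoin ℂ (Set.range fun g => (u g : A))).topologicalClosure

instance {G : Type*} [Group G] {A : Type*} [CStarAlgebra A] (u : G →* unitary A) :
    CStarAlgebra (generatedCStar u) :=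
  StarSubalgebra.cstarAlgebra _
    (h_closed := StarSubalgebra.isClosed_topologicalClosure _)

/-- The reduced group C*-algebra of the discrete group `G`. -/
abbrev ReducedGroupCStar (G : Type u) [Group G] : Type u := generatedCStar (leftRegularRep G)

/-- A unitary representation of the discrete group `G` on a nonzero Hilbert space. -/
structure UnitaryRep (G : Type u) [Group G] : Type (u + 1) where
  /-- The Hilbert space. -/
  H : Type u
  [normed : NormedAddCommGroup H]
  [inner : InnerProductSpace ℂ H]
  [complete : CompleteSpace H]
  [nontriv : Nontrivial H]
  /-- The action. -/
  rep : G →* unitary (H →L[ℂ] H)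

attribute [instance] UnitaryRep.normed UnitaryRep.inner UnitaryRep.complete UnitaryRep.nontriv

/-- The C*-algebra of all bounded families of operators, indexed by the unitary representations
of `G`, with the supremum norm. -/
abbrev RepFamilies (G : Type u) [Group G] : Type (u + 1) :=
  lp (fun π : UnitaryRep G => (π.H →L[ℂ] π.H)) ∞

instance (G : Type u) [Group G] : CStarAlgebra (RepFamilies G) where

/-- The universal unitary representation `g ↦ (π(g))_π`. -/
def universalRep (G : Type u) [Group G] : G →* unitary (RepFamilies G) where
  toFun g :=
    ⟨⟨fun π => (π.rep g : π.H →L[ℂ] π.H), memℓp_infty ⟨1, by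
      rintro _ ⟨π, rfl⟩
      exact CStarRing.norm_coe_unitary (π.rep g) |>.le⟩⟩, by
      constructor
      · ext1; funext π; exact Unitary.coe_star_mul_self (π.rep g)
      · ext1; funext π; exact Unitary.coe_mul_star_self (π.rep g)⟩
  map_one' := by
    apply Subtype.ext; ext1; funext π
    exact congrArg Subtype.val (map_one π.rep)
  map_mul' g₁ g₂ := by
    apply Subtype.ext; ext1; funext π
    exact congrArg Subtype.val (map_mul π.rep g₁ g₂)

/-- The full group C*-algebra of the discrete group `G`: the completion of the group algebra in
the norm `‖x‖ = sup_π ‖π(x)‖` over all unitary representations `π` of `G`. Every cyclic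
representation of `G` is equivalent to one on a Hilbert space in the universe of `G`. -/
abbrev FullGroupCStar (G : Type u) [Group G] : Type (u + 1) := generatedCStar (universalRep G)

/-! ### Residual finite dimensionality -/

/-- A C*-algebra `R` is residually finite dimensional if its *-homomorphisms to finite dimensional
C*-algebras separate the nonzero elements from `0`. (Every finite dimensional C*-algebra has an
isomorphic copy in each universe.) -/
def IsRFD (R : Type u) [CStarAlgebra R] : Prop :=
  ∀ x : R, x ≠ 0 → ∃ (B : Type u) (_ : CStarAlgebra B) (_ : FiniteDimensional ℂ B)
    (π : R →⋆ₙₐ[ℂ] B), π x ≠ 0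

end

/-!
There are two elements `g`, `h` of `F` which do not commute, but whose images commute in every
finite-dimensional C*-algebra. So `hg - gh` is a nonzero element of both group C*-algebras (the
group embeds in each) that every *-homomorphism to a finite-dimensional C*-algebra kills.

The elements come with a third one, `t`, such that both `g` and `h` commute with `tᵐ g t⁻ᵐ` for all
`m ≥ 1`; then all the conjugates `tᵏ g t⁻ᵏ` commute with each other. In a finite-dimensional
C*-algebra there are only finitely many possible values for commuting conjugates of one unitary,
since they are simultaneously diagonalizable with eigenvalues in one finite set
(`exists_lt_eq_of_commute_of_conj`). Hence two of the conjugates have the same image, so `g` has the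
same image as some `tᵐ g t⁻ᵐ` with `m ≥ 1`, and the latter commutes with `h`
(`commute_map_of_commute_conj_pow`).

In `F` it suffices that `g` and `h` are supported in an interval `[d, c]` with `t d = c`, for then
`tᵐ g t⁻ᵐ` is supported in `[c, 1]` (`ThompsonF.exists_commute_conj_pow`).
-/

/-! ### Commuting conjugates in finite-dimensional C*-algebras -/

open scoped IsMulCommutative in
/-- In a finite-dimensional C*-algebra, a commuting sequence of conjugates of one unitary repeats:
the commutative C*-algebra which the sequence generates has finitely many characters, a character
maps every term to a root of one polynomial, and the characters determine the terms. -/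
theorem exists_lt_eq_of_commute_of_conj {B : Type*} [CStarAlgebra B] [FiniteDimensional ℂ B]
    (a t : ℕ → unitary B) (b : unitary B) (hconj : ∀ k, a k = t k * b * (t k)⁻¹)
    (hcomm : ∀ j k, Commute (a j) (a k)) : ∃ j k, j < k ∧ a j = a k := by
  let s : Set B := Set.range fun k => (a k : B)
  have hc : ∀ x ∈ s, ∀ y ∈ s, x * y = y * x := by
    rintro _ ⟨j, rfl⟩ _ ⟨k, rfl⟩
    exact congrArg Subtype.val (hcomm j k).eq
  have hcs : ∀ x ∈ s, ∀ y ∈ s, x * star y = star y * x := by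
    rintro _ ⟨j, rfl⟩ _ ⟨k, rfl⟩
    exact congrArg Subtype.val ((hcomm j k).inv_right).eq
  let C : StarSubalgebra ℂ B := StarAlgebra.adjoin ℂ s
  have : IsMulCommutative C := StarAlgebra.isMulCommutative_adjoin ℂ hc hcs
  have hclosed : IsClosed (C : Set B) := C.toSubalgebra.toSubmodule.closed_of_finiteDimensional
  let : CommCStarAlgebra C := { StarSubalgebra.cstarAlgebra C with mul_comm := mul_comm }
  have hfd : FiniteDimensional ℂ C := inferInstanceAs (FiniteDimensional ℂ C.toSubalgebra.toSubmodule)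
  have : Finite (C →ₐ[ℂ] ℂ) := (linearIndependent_toLinearMap ℂ C ℂ).finite
  have : Finite (WeakDual.characterSpace ℂ C) :=
    Finite.of_injective WeakDual.CharacterSpace.toAlgHom fun φ ψ h => by
      ext x
      exact DFunLike.congr_fun h x
  let p := minpoly ℂ (b : B)
  have hp : p ≠ 0 := minpoly.ne_zero (Algebra.IsIntegral.isIntegral _)
  let c : ℕ → C := fun k => ⟨a k, StarAlgebra.subset_adjoin ℂ s ⟨k, rfl⟩⟩
  have hpc : ∀ k, Polynomial.aeval (c k) p = 0 := fun k => by
    have h1 : Polynomial.aeval ((a k : B)) p = 0 := by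
      let e : B ≃ₐ[ℂ] B := MulSemiringAction.toAlgEquiv ℂ B (ConjAct.toConjAct (Unitary.toUnits (t k)))
      have he : e (b : B) = a k := by
        rw [hconj]; rfl
      rw [← he, ← AlgEquiv.coe_toAlgHom, Polynomial.aeval_algHom_apply, minpoly.aeval, map_zero]
    have h2 := Polynomial.aeval_algHom_apply C.toSubalgebra.val (c k) p
    apply Subtype.ext
    exact h2.symm.trans h1
  let F : ℕ → WeakDual.characterSpace ℂ C → p.rootSet ℂ := fun k χ => ⟨χ (c k), by
    rw [Polynomial.mem_rootSet]
    refine ⟨hp, ?_⟩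
    have := Polynomial.aeval_algHom_apply (WeakDual.CharacterSpace.toAlgHom χ) (c k) p
    rw [hpc, map_zero] at this
    exact this⟩
  obtain ⟨j, k, hjk, hF⟩ := Finite.exists_ne_map_eq_of_infinite F
  have hac : c j = c k := (gelfandTransform_bijective C).1 <| by
    ext χ
    exact congrArg Subtype.val (congrFun hF χ)
  have hajk : a j = a k := Subtype.ext (congrArg (fun x : C => (x : B)) hac)
  rcases hjk.lt_or_gt with h | h
  · exact ⟨j, k, h, hajk⟩
  · exact ⟨k, j, h, hajk.symm⟩

/-- If `g` and `h` commute with `tᵐ g t⁻ᵐ` for all `m ≥ 1`, then `h` and `g` commute in every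
finite-dimensional unitary representation: by repetition among the conjugates, `g` has the same
image there as some `tᵐ g t⁻ᵐ`. -/
theorem commute_map_of_commute_conj_pow {G : Type*} [Group G] {B : Type*} [CStarAlgebra B]
    [FiniteDimensional ℂ B] (τ : G →* unitary B) {g h t : G}
    (hg : ∀ m : ℕ, m ≠ 0 → Commute g (t ^ m * g * (t ^ m)⁻¹))
    (hh : ∀ m : ℕ, m ≠ 0 → Commute h (t ^ m * g * (t ^ m)⁻¹)) : Commute (τ h) (τ g) := by
  -- Conjugation by `tʲ` reduces the commutation of two conjugates to the case that one is `g`.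
  have hadd : ∀ j m : ℕ, t ^ (j + m) * g * (t ^ (j + m))⁻¹ =
      MulAut.conj (t ^ j) (t ^ m * g * (t ^ m)⁻¹) := fun j m => by
    rw [MulAut.conj_apply, pow_add]; group
  have hlt : ∀ j k : ℕ, j < k →
      Commute (t ^ j * g * (t ^ j)⁻¹) (t ^ k * g * (t ^ k)⁻¹) := fun j k hjk => by
    obtain ⟨m, rfl⟩ := Nat.exists_eq_add_of_lt hjk
    rw [add_assoc, hadd, ← MulAut.conj_apply]
    exact (hg _ (Nat.succ_ne_zero m)).map _
  have hcomm : ∀ j k : ℕ, Commute (t ^ j * g * (t ^ j)⁻¹) (t ^ k * g * (t ^ k)⁻¹) := fun j k => by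
    rcases lt_trichotomy j k with h | rfl | h
    · exact hlt j k h
    · exact Commute.refl _
    · exact (hlt k j h).symm
  obtain ⟨j, k, hjk, heq⟩ := exists_lt_eq_of_commute_of_conj
    (fun k => τ (t ^ k * g * (t ^ k)⁻¹)) (fun k => τ (t ^ k)) (τ g)
    (fun k => by simp) (fun j k => (hcomm j k).map τ)
  obtain ⟨m, rfl⟩ := Nat.exists_eq_add_of_lt hjk
  have hgm : τ g = τ (t ^ (m + 1) * g * (t ^ (m + 1))⁻¹) := by
    rw [add_assoc, hadd] at heq
    simp only [MulAut.conj_apply, map_mul τ (t ^ j * _), map_mul τ (t ^ j), map_inv] at heq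
    rw [map_mul, map_mul, map_inv]
    simpa using heq
  rw [hgm]
  exact (hh _ (Nat.succ_ne_zero m)).map τ

/-! ### Residually finite dimensional C*-algebras generated by groups -/

/-- The unital representation that a possibly non-unital *-homomorphism `π` induces on a group of
unitaries: complete `π ∘ u` by the identity on the complement of the projection `π 1`. -/
noncomputable def unitalRep {G : Type*} [Group G] {A B : Type*} [CStarAlgebra A] [CStarAlgebra B]
    (u : G →* unitary A) (π : A →⋆ₙₐ[ℂ] B) : G →* unitary B :=
  have hmul : ∀ v w : A, (π v + (1 - π 1)) * (π w + (1 - π 1)) = π (v * w) + (1 - π 1) :=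
    fun v w => by
      have h1 : π v * π 1 = π v := by rw [← map_mul, mul_one]
      have h2 : π 1 * π w = π w := by rw [← map_mul, one_mul]
      have h3 : π 1 * π 1 = π 1 := by rw [← map_mul, one_mul]
      rw [map_mul]
      simp only [add_mul, mul_add, sub_mul, mul_sub, one_mul, mul_one, h1, h2, h3]
      abel
  have hstar : ∀ v : A, star (π v + (1 - π 1)) = π (star v) + (1 - π 1) := fun v => by
    rw [star_add, star_sub, star_one, ← map_star, ← map_star, star_one]
  { toFun := fun g => ⟨π (u g) + (1 - π 1), by
      rw [Unitary.mem_iff, hstar, hmul, hmul, (u g).2.1, (u g).2.2]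
      simp⟩
    map_one' := Subtype.ext (by simp)
    map_mul' := fun g h => Subtype.ext (by simp [hmul]) }

/-- If `g`, `h`, `t` are as in `commute_map_of_commute_conj_pow`, then a C*-algebra generated by a
faithful unitary representation of a group in which `h` and `g` do not commute is not
residually finite dimensional. -/
theorem not_isRFD_generatedCStar {G : Type*} [Group G] {A : Type*} [CStarAlgebra A]
    (u : G →* unitary A) {g h t : G}
    (hg : ∀ m : ℕ, m ≠ 0 → Commute g (t ^ m * g * (t ^ m)⁻¹))
    (hh : ∀ m : ℕ, m ≠ 0 → Commute h (t ^ m * g * (t ^ m)⁻¹))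
    (hne : ¬ Commute h g) (hu : Function.Injective u) : ¬ IsRFD (generatedCStar u) := by
  intro hR
  have hmem : ∀ x, (u x : A) ∈ generatedCStar u := fun x =>
    StarSubalgebra.le_topologicalClosure _ (StarAlgebra.subset_adjoin ℂ _ ⟨x, rfl⟩)
  let v : G →* unitary (generatedCStar u) :=
    { toFun := fun x => ⟨⟨u x, hmem x⟩, Unitary.mem_iff.2
        ⟨Subtype.ext (Unitary.coe_star_mul_self (u x)),
          Subtype.ext (Unitary.coe_mul_star_self (u x))⟩⟩
      map_one' := Subtype.ext (Subtype.ext (by simp))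
      map_mul' := fun x y => Subtype.ext (Subtype.ext (by simp)) }
  have hv : (v (h * g) : generatedCStar u) - v (g * h) ≠ 0 := fun h0 => hne <| hu <| by
    have h1 := congrArg (fun x : generatedCStar u => (x : A)) (sub_eq_zero.1 h0)
    exact Subtype.ext h1
  obtain ⟨B, _, _, π, hπ⟩ := hR _ hv
  refine hπ ?_
  have h1 := (commute_map_of_commute_conj_pow (unitalRep v π) hg hh).eq
  rw [← map_mul, ← map_mul] at h1
  rw [map_sub, sub_eq_zero]
  exact add_right_cancel (congrArg Subtype.val h1)

/-! ### Faithfulness of the regular and the universal representation -/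

theorem leftRegularRep_apply {G : Type*} [Group G] (g : G) (ψ : GroupL2 G) :
    (leftRegularRep G g : GroupL2 G →L[ℂ] GroupL2 G) ψ = leftTranslate g ψ := rfl

theorem leftRegularRep_injective (G : Type*) [Group G] :
    Function.Injective (leftRegularRep G) := by
  classical
  refine (injective_iff_map_eq_one _).2 fun g hg => ?_
  by_contra hne
  let δ : GroupL2 G := lp.single 2 1 1
  have h : leftTranslate g δ = δ := by
    rw [← leftRegularRep_apply, hg]
    rfl
  have h1 : leftTranslate g δ g = δ g := by rw [h]
  rw [leftTranslate_apply, inv_mul_cancel, lp.single_apply_self, lp.single_apply_ne _ _ _ hne] at h1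
  exact one_ne_zero h1

/-- The regular representation is one of the representations that make up the universal one. -/
theorem universalRep_injective (G : Type*) [Group G] : Function.Injective (universalRep G) := by
  classical
  have : Nontrivial (GroupL2 G) := ⟨lp.single 2 1 1, 0, fun h => by
    have h1 := congrArg (fun ψ : GroupL2 G => ψ 1) h
    simp only [lp.single_apply_self] at h1
    exact one_ne_zero h1⟩
  intro g₁ g₂ h
  have h1 : (universalRep G g₁ : RepFamilies G) = universalRep G g₂ := congrArg Subtype.val h
  exact leftRegularRep_injective G <| Subtype.ext <|
    congrArg (fun f : RepFamilies G => f { H := GroupL2 G, rep := leftRegularRep G }) h1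

/-! ### Bumps in Thompson's group -/

/-- The bump of height `L / 4` on `[a, a + L]`: the identity off this interval, and on it the copy
of the map with slopes `2`, `1`, `1 / 2` on `[0, 1 / 4]`, `[1 / 4, 1 / 2]`, `[1 / 2, 1]`. This map
is concave, so it is a minimum of three affine maps. -/
noncomputable def bumpFun (a L x : ℝ) : ℝ :=
  max x (min (2 * x - a) (min (x + L / 4) ((x + a + L) / 2)))

/-- The inverse of `bumpFun a L`. -/
noncomputable def bumpInv (a L y : ℝ) : ℝ :=
  min y (max ((y + a) / 2) (max (y - L / 4) (2 * y - a - L)))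

theorem bumpInv_bumpFun {a L : ℝ} (hL : 0 < L) (x : ℝ) : bumpInv a L (bumpFun a L x) = x := by
  unfold bumpInv bumpFun
  grind

theorem bumpFun_bumpInv {a L : ℝ} (hL : 0 < L) (x : ℝ) : bumpFun a L (bumpInv a L x) = x := by
  unfold bumpInv bumpFun
  grind

theorem bumpFun_strictMono (a L : ℝ) : StrictMono (bumpFun a L) := fun x y h => by
  unfold bumpFun
  grind

theorem bumpFun_mem {a L x : ℝ} (haL : a + L ≤ 1) (hx : x ∈ Set.Icc (0 : ℝ) 1) :
    bumpFun a L x ∈ Set.Icc (0 : ℝ) 1 := by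
  obtain ⟨h0, h1⟩ := hx
  unfold bumpFun
  constructor <;> grind

theorem bumpInv_mem {a L x : ℝ} (ha : 0 ≤ a) (hx : x ∈ Set.Icc (0 : ℝ) 1) :
    bumpInv a L x ∈ Set.Icc (0 : ℝ) 1 := by
  obtain ⟨h0, h1⟩ := hx
  unfold bumpInv
  constructor <;> grind

/-- The bump on `[a, a + L]` as a homeomorphism of the unit interval. -/
noncomputable def bumpHomeo {a L : ℝ} (ha : 0 ≤ a) (hL : 0 < L) (haL : a + L ≤ 1) :
    unitInterval ≃ₜ unitInterval where
  toFun x := ⟨bumpFun a L x, bumpFun_mem haL x.2⟩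
  invFun y := ⟨bumpInv a L y, bumpInv_mem ha y.2⟩
  left_inv x := Subtype.ext (bumpInv_bumpFun hL x)
  right_inv y := Subtype.ext (bumpFun_bumpInv hL y)
  continuous_toFun := by unfold bumpFun; fun_prop
  continuous_invFun := by unfold bumpInv; fun_prop

theorem bumpHomeo_isThompsonMap {a L : ℝ} (ha : 0 ≤ a) (hL : 0 < L) (haL : a + L ≤ 1)
    (had : a ∈ dyadicRationals) (hLd : L ∈ dyadicRationals) :
    IsThompsonMap (bumpHomeo ha hL haL) := by
  have hquarter : L / 4 ∈ dyadicRationals := by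
    convert dyadicRationals_zpow_mul hLd (-2) using 1
    norm_num; ring
  have hhalf : L / 2 ∈ dyadicRationals := by
    convert dyadicRationals_zpow_mul hLd (-1) using 1
    norm_num; ring
  let S : Set unitInterval :=
    {⟨a, ha, by linarith⟩, ⟨a + L / 4, by linarith, by linarith⟩,
      ⟨a + L / 2, by linarith, by linarith⟩, ⟨a + L, by linarith, haL⟩}
  refine ⟨fun x y h => bumpFun_strictMono a L h, S, Set.toFinite _, ?_, fun c d hcd hdis => ?_⟩
  · rintro s (rfl | rfl | rfl | rfl)
    · exact had
    · exact dyadicRationals_add had hquarter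
    · exact dyadicRationals_add had hhalf
    · exact dyadicRationals_add had hLd
  · have hside : ∀ s ∈ S, (s : ℝ) ≤ c ∨ (d : ℝ) ≤ s := fun s hs => by
      by_contra! h
      exact Set.disjoint_left.1 hdis (show s ∈ Set.Ioo c d from h) hs
    have h1 : a ≤ c ∨ d ≤ a := hside _ (Or.inl rfl)
    have h2 : a + L / 4 ≤ c ∨ d ≤ a + L / 4 := hside _ (Or.inr (Or.inl rfl))
    have h3 : a + L / 2 ≤ c ∨ d ≤ a + L / 2 := hside _ (Or.inr (Or.inr (Or.inl rfl)))
    have h4 : a + L ≤ c ∨ d ≤ a + L := hside _ (Or.inr (Or.inr (Or.inr rfl)))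
    have hcd' : (c : ℝ) < d := hcd
    suffices h : ∃ n : ℤ, ∀ x y : ℝ, (c : ℝ) ≤ x → x ≤ d → y = c →
        bumpFun a L x = bumpFun a L y + 2 ^ n * (x - y) by
      obtain ⟨n, hn⟩ := h
      exact ⟨n, fun t ht => hn t c ht.1 ht.2 rfl⟩
    unfold bumpFun
    by_cases k1 : (d : ℝ) ≤ a
    · exact ⟨0, fun x y hx hy hyc => by rw [zpow_zero]; grind⟩
    by_cases k2 : (d : ℝ) ≤ a + L / 4
    · exact ⟨1, fun x y hx hy hyc => by rw [zpow_one]; grind⟩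
    by_cases k3 : (d : ℝ) ≤ a + L / 2
    · exact ⟨0, fun x y hx hy hyc => by rw [zpow_zero]; grind⟩
    by_cases k4 : (d : ℝ) ≤ a + L
    · exact ⟨-1, fun x y hx hy hyc => by rw [zpow_neg_one]; grind⟩
    · exact ⟨0, fun x y hx hy hyc => by rw [zpow_zero]; grind⟩

/-- The bump on `[a, a + L]` as an element of Thompson's group. -/
noncomputable def bump {a L : ℝ} (ha : 0 ≤ a) (hL : 0 < L) (haL : a + L ≤ 1)
    (had : a ∈ dyadicRationals) (hLd : L ∈ dyadicRationals) : ThompsonF :=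
  ⟨bumpHomeo ha hL haL, bumpHomeo_isThompsonMap ha hL haL had hLd⟩

theorem bumpFun_of_le {a L x : ℝ} (hL : 0 < L) (hx : a + L ≤ x) : bumpFun a L x = x := by
  unfold bumpFun
  grind

theorem ThompsonF.mul_apply (f g : ThompsonF) (x : unitInterval) :
    (f * g).1 x = f.1 (g.1 x) := rfl

theorem ThompsonF.apply_inv_apply (f : ThompsonF) (x : unitInterval) : f.1 (f⁻¹.1 x) = x :=
  f.1.apply_symm_apply x

theorem ThompsonF.ext_apply {f g : ThompsonF} (h : ∀ x, f.1 x = g.1 x) : f = g :=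
  Subtype.ext (Homeomorph.ext h)

/-- Elements supported on either side of a point commute. -/
theorem ThompsonF.commute_of_fixed {f g : ThompsonF} (c : unitInterval)
    (hf : ∀ x, c ≤ x → f.1 x = x) (hg : ∀ x, x ≤ c → g.1 x = x) : Commute f g := by
  refine ThompsonF.ext_apply fun x => ?_
  rw [mul_apply, mul_apply]
  have hfm := f.2.1.monotone
  have hgm := g.2.1.monotone
  rcases le_total x c with h | h
  · have h1 := hfm h
    rw [hf c le_rfl] at h1
    rw [hg x h, hg _ h1]
  · have h1 := hgm h
    rw [hg c le_rfl] at h1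
    rw [hf x h, hf _ h1]

/-- Conjugation by powers of an element that maps `d` to `c ≥ d` moves support in `[d, 1]` into
`[c, 1]`. -/
theorem ThompsonF.conj_pow_fixed {g t : ThompsonF} {c d : unitInterval} (hdc : d ≤ c)
    (ht : t.1 d = c) (hg : ∀ x, x ≤ d → g.1 x = x) {m : ℕ} (hm : m ≠ 0) (x : unitInterval)
    (hx : x ≤ c) : (t ^ m * g * (t ^ m)⁻¹).1 x = x := by
  have hpow : ∀ n : ℕ, c ≤ (t ^ (n + 1)).1 d := fun n => by
    induction n with
    | zero => rw [zero_add, pow_one, ht]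
    | succ n ih =>
      rw [pow_succ', mul_apply]
      calc c = t.1 d := ht.symm
        _ ≤ _ := t.2.1.monotone (hdc.trans ih)
  obtain ⟨n, rfl⟩ := Nat.exists_eq_succ_of_ne_zero hm
  have hle : ((t ^ (n + 1))⁻¹).1 x ≤ d := by
    rw [← (t ^ (n + 1)).2.1.le_iff_le, apply_inv_apply]
    exact hx.trans (hpow n)
  rw [mul_apply, mul_apply, hg _ hle, apply_inv_apply]

/-- The bumps `t` on `[0, 1]`, `g` on `[1/2, 3/4]` and `h` on `[1/2, 5/8]`: as `t` maps `1/2` to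
`3/4`, the conjugates of `g` by positive powers of `t` are supported in `[3/4, 1]`. -/
theorem ThompsonF.exists_commute_conj_pow : ∃ g h t : ThompsonF,
    (∀ m : ℕ, m ≠ 0 → Commute g (t ^ m * g * (t ^ m)⁻¹)) ∧
    (∀ m : ℕ, m ≠ 0 → Commute h (t ^ m * g * (t ^ m)⁻¹)) ∧ ¬ Commute h g := by
  have d0 : (0 : ℝ) ∈ dyadicRationals := ⟨0, 0, by norm_num⟩
  have d1 : (1 : ℝ) ∈ dyadicRationals := ⟨1, 0, by norm_num⟩
  have d2 : (1 / 2 : ℝ) ∈ dyadicRationals := ⟨1, 1, by norm_num⟩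
  have d4 : (1 / 4 : ℝ) ∈ dyadicRationals := ⟨1, 2, by norm_num⟩
  have d8 : (1 / 8 : ℝ) ∈ dyadicRationals := ⟨1, 3, by norm_num⟩
  let t : ThompsonF := bump le_rfl one_pos (by norm_num) d0 d1
  let g : ThompsonF := bump (by norm_num) (by norm_num) (by norm_num) d2 d4
  let h : ThompsonF := bump (by norm_num) (by norm_num) (by norm_num) d2 d8
  let c : unitInterval := ⟨3 / 4, by norm_num, by norm_num⟩
  let d : unitInterval := ⟨1 / 2, by norm_num, by norm_num⟩
  have ht : t.1 d = c := Subtype.ext (show bumpFun 0 1 (1 / 2) = 3 / 4 by norm_num [bumpFun])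
  have hgd : ∀ x, x ≤ d → g.1 x = x := fun x hx => by
    have hx' : (x : ℝ) ≤ 1 / 2 := hx
    refine Subtype.ext (show bumpFun (1 / 2) (1 / 4) x = x from ?_)
    unfold bumpFun
    grind
  have hgc : ∀ x, c ≤ x → g.1 x = x := fun x hx => by
    have hx' : (3 / 4 : ℝ) ≤ x := hx
    exact Subtype.ext (bumpFun_of_le (by norm_num) (by linarith))
  have hhc : ∀ x, c ≤ x → h.1 x = x := fun x hx => by
    have hx' : (3 / 4 : ℝ) ≤ x := hx
    exact Subtype.ext (bumpFun_of_le (by norm_num) (by linarith))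
  have hdc : d ≤ c := show (1 / 2 : ℝ) ≤ 3 / 4 by norm_num
  refine ⟨g, h, t, fun m hm => commute_of_fixed c hgc fun x => conj_pow_fixed hdc ht hgd hm x,
    fun m hm => commute_of_fixed c hhc fun x => conj_pow_fixed hdc ht hgd hm x, fun h1 => ?_⟩
  -- `h ∘ g` maps `9/16` to the endpoint `5/8` of the support of `h`, while `g ∘ h` maps it to
  -- `21/32`.
  have h2 := congrArg (fun f : ThompsonF => (f.1 ⟨9 / 16, by norm_num, by norm_num⟩ : ℝ))
    h1.eq
  have h3 : bumpFun (1 / 2) (1 / 8) (bumpFun (1 / 2) (1 / 4) (9 / 16)) =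
      bumpFun (1 / 2) (1 / 4) (bumpFun (1 / 2) (1 / 8) (9 / 16)) := h2
  norm_num [bumpFun] at h3

/-- The reduced and the full group C*-algebra of Thompson's group `F` are not residually finite
dimensional. -/
theorem theorem4p7 :
    ¬ IsRFD (ReducedGroupCStar ThompsonF) ∧ ¬ IsRFD (FullGroupCStar ThompsonF) := by
  obtain ⟨g, h, t, hg, hh, hne⟩ := ThompsonF.exists_commute_conj_pow
  exact ⟨not_isRFD_generatedCStar _ hg hh hne (leftRegularRep_injective _),
    not_isRFD_generatedCStar _ hg hh hne (universalRep_injective _)⟩
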